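/- Let $K=\mathbb{Q}(i)$, $\zeta_{15}=e^{2\pi i/15}$, $\theta=\zeta_{15}+\zeta_{15}^{-1}=2\cos(2\pi/15)$, $L=K(\theta)$ with ring of integers $\mathcal{O}_L$, let $\sigma$ be the $K$-automorphism of $L$ with $\sigma(\zeta_{15}+\zeta_{15}^{-1})=\zeta_{15}^2+\zeta_{15}^{-2}$, and put $\gamma=i$, $\alpha=(1-3i)+i\theta^2$. For $x=(x_0,\dots,x_3)\in\mathcal{O}_L^4$ let $$\mathbf{X}(x)=\operatorname{diag}\bigl(\alpha,\sigma(\alpha),\sigma^2(\alpha),\sigma^3(\alpha)\bigr)\begin{pmatrix}x_0&x_1&x_2&x_3\\ \gamma\sigma(x_3)&\sigma(x_0)&\sigma(x_1)&\sigma(x_2)\\ \gamma\sigma^2(x_2)&\gamma\sigma^2(x_3)&\sigma^2(x_0)&\sigma^2(x_1)\\ \gamma\sigma^3(x_1)&\gamma\sigma^3(x_2)&\gamma\sigma^3(x_3)&\sigma^3(x_0)\end{pmatrix}$$ be the corresponding codeword of the $4\times4$ perfect space-time code. Let $\mathfrak{q}_1,\dots,\mathfrak{q}_N$ be nonzero,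 pairwise relatively prime ideals of $\mathcal{O}_L$, $\mathfrak{q}=\mathfrak{q}_1\cdots\mathfrak{q}_N$, and let $\mathcal{M}$ map each element of $\prod_k\mathcal{O}_L/\mathfrak{q}_k\cong\mathcal{O}_L/\mathfrak{q}$ to a representative in $\mathcal{O}_L$ of the corresponding coset of $\mathfrak{q}$. The messages are $w_k=(w_{k,0},\dots,w_{k,3})\in(\mathcal{O}_L/\mathfrak{q}_k)^4$, $1\le k\le N$; they are encoded as $\mathbf{X}(x)$ with $x_\ell=\mathcal{M}(w_{1,\ell},\dots,w_{N,\ell})$. Let $\mathcal{C}$ be the resulting codebook and, for $\mathcal{S}\subseteq\{1,\dots,N\}$ and given values $v_s$ $(s\in\mathcal{S})$, let $\mathcal{C}_{\mathcal{S}}$ be the subcode of the codewords with $w_s=v_s$ for all $s\in\mathcal{S}$. For $\mathcal{D}=\mathcal{C}$ or $\mathcal{D}=\mathcal{C}_{\mathcal{S}}$ the minimum determinant is that of the (translated) lattice from which $\mathcal{D}$ is carved, $$\delta(\mathcal{D})=\min\bigl\{\det\bigl((X-X')(X-X')^\dagger\bigr): X\ne X'\in\mathcal{D}+\{\mathbf{X}(z):z\in\mathfrak{q}^4\}\bigr\}.$$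 The rate of $w_k$ is $R_k=\frac{1}{32}\log_2\bigl|(\mathcal{O}_L/\mathfrak{q}_k)^4\bigr|$ bits per real symbol, and the normalized side information gain is $$\Gamma(\mathcal{C},\mathcal{S})=\frac{10\log_{10}\bigl(\delta(\mathcal{C}_{\mathcal{S}})/\delta(\mathcal{C})\bigr)}{4\sum_{s\in\mathcal{S}}R_s}.$$ Then for every $\mathcal{S}$ such that $\mathfrak{q}_s\ne\mathcal{O}_L$ for at least one $s\in\mathcal{S}$ (equivalently, $\sum_{s\in\mathcal{S}}R_s>0$), and for all values $v_s$, both minima exist and $$\Gamma(\mathcal{C},\mathcal{S})\ge 20\log_{10}2\approx 6.02\ \text{dB per bit per real symbol}.$$ Moreover, if all $\mathfrak{q}_k$ are principal, then $\Gamma(\mathcal{C},\mathcal{S})=20\log_{10}2$. -/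

import Mathlib

open scoped NumberField

namespace LSTIC

noncomputable section

/-! ### The cyclic extension `L / K` -/

/-- `K = ℚ(i)`, as a subfield of `ℂ`. -/
abbrev K : IntermediateField ℚ ℂ := IntermediateField.adjoin ℚ {Complex.I}

/-- `θ = 2 cos(2π/15) = ζ₁₅ + ζ₁₅⁻¹`. -/
def theta : ℂ := 2 * Complex.cos (2 * Real.pi / 15)

/-- `2 cos(4π/15) = ζ₁₅² + ζ₁₅⁻²`. -/
def theta' : ℂ := 2 * Complex.cos (4 * Real.pi / 15)

/-- `L = K(θ) = ℚ(i, 2 cos(2π/15))`, as a subfield of `ℂ`. -/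
abbrev L : IntermediateField K ℂ := IntermediateField.adjoin K {theta}

lemma theta'_eq : theta' = theta ^ 2 - 2 := by
  have h : (4 * Real.pi / 15 : ℂ) = 2 * (2 * Real.pi / 15) := by ring
  rw [theta', theta, h, Complex.cos_two_mul]
  ring

lemma isIntegral_theta : IsIntegral K theta := by
  have h15 : IsIntegral K (Complex.exp (2 * Real.pi * Complex.I / 15)) := by
    have := (Complex.isPrimitiveRoot_exp 15 (by norm_num)).isIntegral (by norm_num)
    exact_mod_cast this.tower_top
  have h15' : IsIntegral K (Complex.exp (2 * Real.pi * Complex.I / 15))⁻¹ := by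
    have := ((Complex.isPrimitiveRoot_exp 15 (by norm_num)).inv).isIntegral (by norm_num)
    exact_mod_cast this.tower_top
  have h : theta = Complex.exp (2 * Real.pi * Complex.I / 15)
      + (Complex.exp (2 * Real.pi * Complex.I / 15))⁻¹ := by
    rw [theta, Complex.two_cos, ← Complex.exp_neg]
    congr 2 <;> ring
  rw [h]
  exact h15.add h15'

/-- `2 cos(4π/15)` is conjugate to `2 cos(2π/15)` over `ℚ(i)`. -/
lemma aeval_theta' : Polynomial.aeval theta' (minpoly K theta) = 0 := by
  set ζ : ℂ := Complex.exp (2 * Real.pi * Complex.I / 60) with hζ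
  have hprim : IsPrimitiveRoot ζ 60 := by
    have := Complex.isPrimitiveRoot_exp 60 (by norm_num)
    simpa using this
  have hint : IsIntegral ℚ ζ := (hprim.isIntegral (by norm_num)).tower_top
  have hprim' : IsPrimitiveRoot (ζ ^ 17) 60 := hprim.pow_of_coprime 17 (by norm_num)
  have hroot : Polynomial.aeval (ζ ^ 17) (minpoly ℚ ζ) = 0 := by
    rw [← Polynomial.cyclotomic_eq_minpoly_rat hprim (by norm_num),
      Polynomial.cyclotomic_eq_minpoly_rat hprim' (by norm_num)]
    exact minpoly.aeval _ _
  have hI : ζ ^ 15 = Complex.I := by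
    have h : Complex.I = Complex.exp (Real.pi / 2 * Complex.I) :=
      Complex.exp_pi_div_two_mul_I.symm
    rw [h, hζ, ← Complex.exp_nat_mul]
    congr 1
    push_cast
    ring
  have hth : theta = ζ ^ 4 + (ζ ^ 4)⁻¹ := by
    rw [theta, Complex.two_cos, hζ, ← Complex.exp_nat_mul, ← Complex.exp_neg]
    congr 2 <;> (push_cast; ring)
  let E : IntermediateField ℚ ℂ := IntermediateField.adjoin ℚ {ζ}
  let g : E := IntermediateField.AdjoinSimple.gen ℚ ζ
  have hg : (g : ℂ) = ζ := IntermediateField.AdjoinSimple.coe_gen ℚ ζ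
  let φ : E →ₐ[ℚ] ℂ := (IntermediateField.algHomAdjoinIntegralEquiv ℚ hint).symm
    ⟨ζ ^ 17, Polynomial.mem_aroots.2 ⟨minpoly.ne_zero hint, hroot⟩⟩
  have hφg : φ g = ζ ^ 17 :=
    IntermediateField.algHomAdjoinIntegralEquiv_symm_apply_gen ℚ hint _
  have hKE : K ≤ E := by
    rw [IntermediateField.adjoin_simple_le_iff, ← hI]
    exact pow_mem (IntermediateField.mem_adjoin_simple_self ℚ ζ) 15
  let ι : K →ₐ[ℚ] E := IntermediateField.inclusion hKE
  have hfix : φ.comp ι = K.val := by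
    refine IntermediateField.algHom_ext_of_eq_adjoin (S := K) (s := {Complex.I}) _ rfl ?_
    intro x hx
    have hx' : x = Complex.I := hx
    subst hx'
    have h1 : ι ⟨Complex.I, IntermediateField.subset_adjoin ℚ _ hx⟩ = g ^ 15 := by
      apply Subtype.ext
      change Complex.I = ((g ^ 15 : E) : ℂ)
      push_cast
      rw [hg, hI]
    change φ (ι _) = Complex.I
    rw [h1, map_pow, hφg, ← pow_mul, ← hI]
    have h60 := hprim.pow_eq_one
    calc ζ ^ (17 * 15) = (ζ ^ 60) ^ 4 * ζ ^ 15 := by ring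
      _ = ζ ^ 15 := by rw [h60]; ring
  let t : E := g ^ 4 + (g ^ 4)⁻¹
  have ht : (t : ℂ) = theta := by
    change ((g ^ 4 + (g ^ 4)⁻¹ : E) : ℂ) = theta
    push_cast
    rw [hg, hth]
  have hφt : φ t = theta' := by
    have h60 := hprim.pow_eq_one
    have hne : ζ ≠ 0 := Complex.exp_ne_zero _
    have h68 : (ζ ^ 17) ^ 4 = ζ ^ 8 := by
      calc (ζ ^ 17) ^ 4 = ζ ^ 60 * ζ ^ 8 := by ring
        _ = ζ ^ 8 := by rw [h60, one_mul]
    change φ (g ^ 4 + (g ^ 4)⁻¹) = theta'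
    rw [map_add, map_inv₀, map_pow, hφg, h68, theta'_eq, hth]
    field_simp
    ring
  have h0 : Polynomial.eval₂ (ι : K →+* E) t (minpoly K theta) = 0 := by
    have hinj : Function.Injective E.val := E.val.injective
    apply hinj
    rw [map_zero]
    have := Polynomial.hom_eval₂ (minpoly K theta) (ι : K →+* E) (E.val : E →+* ℂ) t
    refine this.trans ?_
    have h2 : ((E.val : E →+* ℂ) t) = theta := ht
    rw [h2]
    exact minpoly.aeval K theta
  have h1 := Polynomial.hom_eval₂ (minpoly K theta) (ι : K →+* E) (φ : E →+* ℂ) t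
  rw [h0, map_zero] at h1
  have h3 : ((φ : E →+* ℂ).comp (ι : K →+* E)) = algebraMap K ℂ := by
    ext x
    exact DFunLike.congr_fun hfix x
  have h4 : (φ : E →+* ℂ) t = theta' := hφt
  rw [h3, h4] at h1
  exact h1.symm

lemma exists_sigma : ∃ σ : L ≃ₐ[K] L,
    ((σ (IntermediateField.AdjoinSimple.gen K theta) : L) : ℂ) = theta' := by
  let f : L →ₐ[K] ℂ := (IntermediateField.algHomAdjoinIntegralEquiv K isIntegral_theta).symm
    ⟨theta', Polynomial.mem_aroots.2 ⟨minpoly.ne_zero isIntegral_theta, aeval_theta'⟩⟩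
  have hf : f (IntermediateField.AdjoinSimple.gen K theta) = theta' :=
    IntermediateField.algHomAdjoinIntegralEquiv_symm_apply_gen K isIntegral_theta _
  have hrange : f.fieldRange ≤ L := by
    have h1 : f.fieldRange = IntermediateField.adjoin K {theta'} := by
      rw [← hf, ← Set.image_singleton, ← IntermediateField.adjoin_map,
        AlgHom.fieldRange_eq_map]
      congr 1
      apply IntermediateField.lift_injective L
      rw [IntermediateField.lift_top, IntermediateField.lift_adjoin_simple,
        IntermediateField.AdjoinSimple.coe_gen]
    rw [h1, IntermediateField.adjoin_simple_le_iff, theta'_eq]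
    exact sub_mem (pow_mem (IntermediateField.mem_adjoin_simple_self K theta) 2)
      (ofNat_mem L 2)
  have : FiniteDimensional K L :=
    IntermediateField.adjoin.finiteDimensional isIntegral_theta
  let f' : L →ₐ[K] L := f.codRestrict L.toSubalgebra fun x => hrange ⟨x, rfl⟩
  exact ⟨AlgEquiv.ofBijective f' f'.bijective, hf⟩

/-- The `K`-automorphism `σ` of `L` with `σ(ζ₁₅ + ζ₁₅⁻¹) = ζ₁₅² + ζ₁₅⁻²` (it is the only one, since
`θ` generates `L` over `K`). -/
def sigma : L ≃ₐ[K] L := Classical.choose exists_sigma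

lemma sigma_theta :
    ((sigma (IntermediateField.AdjoinSimple.gen K theta) : L) : ℂ) = theta' :=
  Classical.choose_spec exists_sigma

/-! ### The `4 × 4` perfect code -/

/-- The non-norm element `γ = i`. -/
def gam : ℂ := Complex.I

lemma alpha_mem : (1 - 3 * Complex.I) + Complex.I * theta ^ 2 ∈ L := by
  have hI : Complex.I ∈ L :=
    L.algebraMap_mem ⟨Complex.I, IntermediateField.mem_adjoin_simple_self ℚ Complex.I⟩
  exact add_mem (sub_mem (one_mem L) (mul_mem (ofNat_mem L 3) hI))
    (mul_mem hI (pow_mem (IntermediateField.mem_adjoin_simple_self K theta) 2))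

/-- `α = (1 - 3i) + i θ²`. -/
def alpha : L := ⟨(1 - 3 * Complex.I) + Complex.I * theta ^ 2, alpha_mem⟩

/-- The diagonal matrix `D(a) = diag(a, σ(a), σ²(a), σ³(a))`. -/
def diagMatrix (a : L) : Matrix (Fin 4) (Fin 4) ℂ :=
  Matrix.diagonal fun m => (((sigma ^ (m : ℕ)) a : L) : ℂ)

/-- The matrix form of the element `x₀ + x₁ e + x₂ e² + x₃ e³` of the cyclic algebra
`(L/K, σ, γ)`: row `m`, column `j` holds `σᵐ(x_{(j - m) mod 4})`, multiplied by `γ` when `j < m`. -/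
def algMatrix (x : Fin 4 → L) : Matrix (Fin 4) (Fin 4) ℂ :=
  Matrix.of fun m j =>
    (if j < m then gam else 1) * (((sigma ^ (m : ℕ)) (x (j - m)) : L) : ℂ)

/-- The codeword of the `4 × 4` perfect code whose layers carry `x₀, …, x₃ ∈ 𝓞_L`. -/
def codeword (x : Fin 4 → 𝓞 L) : Matrix (Fin 4) (Fin 4) ℂ :=
  diagMatrix alpha * algMatrix fun l => (x l : L)

/-! ### Layered space-time index coding -/

section Code

variable {N : ℕ} (q : Fin N → Ideal (𝓞 L))

/-- The `k`-th message `w_k = (w_{k,0}, …, w_{k,3})` ranges over `(𝓞_L / 𝔮_k)⁴`. -/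
abbrev Message (k : Fin N) : Type := Fin 4 → 𝓞 L ⧸ q k

/-- `M` maps `∏ₖ 𝓞_L / 𝔮_k`, which is `𝓞_L / (𝔮₁ ⋯ 𝔮_N)` by the Chinese remainder theorem, to a
complete set of coset leaders in `𝓞_L`: `M u` lies in the coset with residues `u`. -/
def IsCosetLeaderMap (M : (∀ k, 𝓞 L ⧸ q k) → 𝓞 L) : Prop :=
  ∀ u k, Ideal.Quotient.mk (q k) (M u) = u k

variable {q} in
/-- The encoder: layer `l` carries `x_l = M(w_{1,l}, …, w_{N,l})`. -/
def encode (M : (∀ k, 𝓞 L ⧸ q k) → 𝓞 L) (w : ∀ k, Message q k) :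
    Matrix (Fin 4) (Fin 4) ℂ :=
  codeword fun l => M fun k => w k l

variable {q} in
/-- The codebook `C`. -/
def codebook (M : (∀ k, 𝓞 L ⧸ q k) → 𝓞 L) : Set (Matrix (Fin 4) (Fin 4) ℂ) :=
  {X | ∃ w : ∀ k, Message q k, X = encode M w}

variable {q} in
/-- The subcode `C_S` left when the messages `w_s = v_s`, `s ∈ S`, are known. -/
def subcode (M : (∀ k, 𝓞 L ⧸ q k) → 𝓞 L) (S : Finset (Fin N)) (v : ∀ k, Message q k) :
    Set (Matrix (Fin 4) (Fin 4) ℂ) :=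
  {X | ∃ w : ∀ k, Message q k, (∀ s ∈ S, w s = v s) ∧ X = encode M w}

/-- The lattice code from which a set `C` of codewords is carved: a layer symbol stands for its
coset in `𝓞_L / 𝔮`, `𝔮 = 𝔮₁ ⋯ 𝔮_N`, so `C` is a set of representatives of the (translated) lattice
`C + {codeword z | z₀, …, z₃ ∈ 𝔮}`. -/
def latticeCode (C : Set (Matrix (Fin 4) (Fin 4) ℂ)) : Set (Matrix (Fin 4) (Fin 4) ℂ) :=
  {Y | ∃ X ∈ C, ∃ z : Fin 4 → 𝓞 L, (∀ l, z l ∈ ∏ k, q k) ∧ Y = X + codeword z}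

/-- The determinants of `A = (X - X')(X - X')†` for distinct `X, X' ∈ C` (`A` is positive
semidefinite, so `det A` is real). -/
def pairDets (C : Set (Matrix (Fin 4) (Fin 4) ℂ)) : Set ℝ :=
  {d | ∃ X ∈ C, ∃ X' ∈ C, X ≠ X' ∧ d = ((X - X') * (X - X').conjTranspose).det.re}

/-- The minimum determinant `δ(C)` of a code carved from a lattice, that is, the minimum over the
lattice. -/
def minDet (C : Set (Matrix (Fin 4) (Fin 4) ℂ)) : ℝ := sInf (pairDets (latticeCode q C))

/-- The rate `R_k = log₂(M_k) / r` of the `k`-th message in bits per real symbol, where `M_k` is the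
number of values of `w_k` and a codeword carries `r = 2 · 4²` real symbols. -/
def rate (k : Fin N) : ℝ := Real.logb 2 (Nat.card (Message q k)) / (2 * 4 ^ 2)

variable {q} in
/-- The normalized side information gain
`Γ(C, S) = 10 log₁₀(δ(C_S) / δ(C)) / (n_t R_S)`, `n_t = 4`, `R_S = ∑_{s ∈ S} R_s`. -/
def sideInfoGain (M : (∀ k, 𝓞 L ⧸ q k) → 𝓞 L) (S : Finset (Fin N))
    (v : ∀ k, Message q k) : ℝ :=
  10 * Real.logb 10 (minDet q (subcode M S v) / minDet q (codebook M)) /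
    (4 * ∑ s ∈ S, rate q s)

end Code

end

end LSTIC

/-!
A codeword is the matrix of an element `x` of the cyclic algebra `(L/K, σ, i)`, multiplied by the
diagonal matrix of `α`, so `det (X X†) = |N(α)|² |nrd x|²`. Up to translation, the code in which the
messages in `S` are known consists of the `x` with coordinates in `𝔞 = ∏ s ∈ S, 𝔮ₛ`.

The reduced norm `nrd x` is fixed by `σ`, hence lies in `ℚ(i)`, where `|nrd x|⁸` is the norm of the
ideal it generates in `𝓞_L`. If the coordinates of `x` lie in `𝔞`, then `nrd x ∈ ∏ₘ σᵐ(𝔞)`, an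
ideal of norm `N(𝔞)⁴`; hence `|nrd x|² ≥ N(𝔞)` unless `nrd x = 0`. Equality holds for
`x = (g, 0, 0, 0)` when `𝔞 = (g)`.

That `nrd x ≠ 0` for `x ≠ 0` is seen modulo the prime of `L` above `2 + i`. As `2 + i` is totally
ramified in `L/K`, the automorphism `σ` acts trivially on the residue field `𝔽₅`, and the algebra
reduces to `𝔽₅[e] / (e⁴ - 3)`, which is a field. A nonzero `x` may first be scaled so that it does
not reduce to `0`.

Since `∑ Rₛ = log₂ N(𝔞) / 8`, the gain is `20 log₁₀ 2` times the logarithm of `δ(C_S) / δ(C)` to the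
base `N(𝔞)`.
-/

namespace LSTIC

noncomputable section

section CyclicAlgebra

variable {R : Type*} [CommRing R] {n : ℕ}

/-- The matrix of `x₀ + x₁ e + ⋯ + xₙ₋₁ eⁿ⁻¹` in the cyclic algebra generated over `R` by `e` with
`e r = σ(r) e` and `eⁿ = γ`. The index `j - m` is taken modulo `n`, with a factor `γ` where it
wraps around. -/
def cyclicMatrix (σ : R ≃+* R) (γ : R) (x : Fin n → R) : Matrix (Fin n) (Fin n) R :=
  Matrix.of fun m j => (if j < m then γ else 1) * (σ ^ (m : ℕ)) (x (j - m))

/-- The reduced norm of `x₀ + x₁ e + ⋯ + xₙ₋₁ eⁿ⁻¹` in the cyclic algebra `(σ, γ)` of degree `n`. -/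
def reducedNorm (σ : R ≃+* R) (γ : R) (x : Fin n → R) : R := (cyclicMatrix σ γ x).det

variable (σ : R ≃+* R) (γ : R)

lemma cyclicMatrix_apply (x : Fin n → R) (m j : Fin n) :
    cyclicMatrix σ γ x m j = (if j < m then γ else 1) * (σ ^ (m : ℕ)) (x (j - m)) := rfl

lemma cyclicMatrix_add (x y : Fin n → R) :
    cyclicMatrix σ γ (x + y) = cyclicMatrix σ γ x + cyclicMatrix σ γ y := by
  ext m j
  simp only [cyclicMatrix_apply, Matrix.add_apply, Pi.add_apply, map_add, mul_add]

lemma cyclicMatrix_smul (c : R) (x : Fin n → R) :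
    cyclicMatrix σ γ (c • x) =
      Matrix.diagonal (fun m : Fin n => (σ ^ (m : ℕ)) c) * cyclicMatrix σ γ x := by
  ext m j
  simp only [Matrix.diagonal_mul, cyclicMatrix_apply, Pi.smul_apply, smul_eq_mul, map_mul]
  ring

lemma cyclicMatrix_single_zero [NeZero n] (c : R) :
    cyclicMatrix σ γ (Pi.single 0 c : Fin n → R) =
      Matrix.diagonal fun m : Fin n => (σ ^ (m : ℕ)) c := by
  ext m j
  obtain rfl | hmj := eq_or_ne m j
  · simp [cyclicMatrix_apply]
  · simp [cyclicMatrix_apply, Pi.single_eq_of_ne (sub_ne_zero.2 hmj.symm), hmj]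

lemma reducedNorm_smul (c : R) (x : Fin n → R) :
    reducedNorm σ γ (c • x) = (∏ m : Fin n, (σ ^ (m : ℕ)) c) * reducedNorm σ γ x := by
  rw [reducedNorm, cyclicMatrix_smul, Matrix.det_mul, Matrix.det_diagonal, reducedNorm]

lemma reducedNorm_single_zero [NeZero n] (c : R) :
    reducedNorm σ γ (Pi.single 0 c : Fin n → R) = ∏ m : Fin n, (σ ^ (m : ℕ)) c := by
  rw [reducedNorm, cyclicMatrix_single_zero, Matrix.det_diagonal]

variable {σ}

lemma map_cyclicMatrix {S : Type*} [CommRing S] {τ : S ≃+* S} (φ : R →+* S)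
    (hφ : ∀ r, φ (σ r) = τ (φ r)) (x : Fin n → R) :
    (cyclicMatrix σ γ x).map φ = cyclicMatrix τ (φ γ) (φ ∘ x) := by
  have hpow (m : ℕ) (r : R) : φ ((σ ^ m) r) = (τ ^ m) (φ r) := by
    induction m generalizing r with
    | zero => rfl
    | succ m ih => rw [pow_succ, pow_succ, RingAut.mul_apply, RingAut.mul_apply, ih, hφ]
  ext m j
  simp only [Matrix.map_apply, cyclicMatrix_apply, map_mul, apply_ite φ, map_one, hpow,
    Function.comp_apply]

lemma map_reducedNorm {S : Type*} [CommRing S] {τ : S ≃+* S} (φ : R →+* S)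
    (hφ : ∀ r, φ (σ r) = τ (φ r)) (x : Fin n → R) :
    φ (reducedNorm σ γ x) = reducedNorm τ (φ γ) (φ ∘ x) := by
  rw [reducedNorm, RingHom.map_det, RingHom.mapMatrix_apply, map_cyclicMatrix γ φ hφ, reducedNorm]

/-- Matrix form of the relation `e x = σ(x) e`, with `e` written as a diagonal matrix times a
cyclic permutation. -/
lemma diagonal_mul_submatrix_cyclicMatrix {γ : R} (hσ : σ ^ (n + 1) = 1) (hγ : σ γ = γ)
    (x : Fin (n + 1) → R) :
    Matrix.diagonal (fun m => if m = Fin.last n then γ else 1) *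
        (cyclicMatrix σ γ x).submatrix (Equiv.addRight 1) (Equiv.addRight 1) =
      (cyclicMatrix σ γ x).map σ *
        Matrix.diagonal (fun m => if m = Fin.last n then γ else 1) := by
  ext m j
  have hsub : j + 1 - (m + 1) = j - m := add_sub_add_right_eq_sub j m 1
  simp only [Matrix.diagonal_mul, Matrix.mul_diagonal, Matrix.submatrix_apply,
    Matrix.map_apply, cyclicMatrix_apply, map_mul, Equiv.coe_addRight, hsub,
    apply_ite σ, hγ, map_one, ← RingAut.mul_apply, ← pow_succ']
  cases m using Fin.lastCases with
  | last =>
    cases j using Fin.lastCases with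
    | last => simp [hσ, mul_comm]
    | cast j => simp [hσ, Fin.castSucc_lt_last]
  | cast m =>
    cases j using Fin.lastCases with
    | last => simp [mul_comm, (Fin.castSucc_lt_last m).not_gt]
    | cast j => simp

lemma apply_reducedNorm [IsDomain R] {γ : R} (hσ : σ ^ n = 1) (hγ : σ γ = γ) (hγ0 : γ ≠ 0)
    (x : Fin n → R) : σ (reducedNorm σ γ x) = reducedNorm σ γ x := by
  cases n with
  | zero => simp [reducedNorm]
  | succ n =>
    have hdet := congrArg Matrix.det (diagonal_mul_submatrix_cyclicMatrix hσ hγ x)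
    rw [Matrix.det_mul, Matrix.det_mul, Matrix.det_submatrix_equiv_self, mul_comm] at hdet
    refine (RingHom.map_det (σ : R →+* R) _).trans (mul_right_cancel₀ ?_ hdet).symm
    simpa [Matrix.det_diagonal] using hγ0

variable (σ) {γ}

lemma reducedNorm_mem_prod_map {a : Ideal R} {x : Fin n → R} (hx : ∀ l, x l ∈ a) :
    reducedNorm σ γ x ∈ ∏ m : Fin n, a.map (σ ^ (m : ℕ)) := by
  rw [reducedNorm, ← Matrix.det_transpose, Matrix.det_apply]
  refine Ideal.sum_mem _ fun π _ => Submodule.smul_of_tower_mem _ _ ?_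
  refine Ideal.prod_mem_prod fun m _ => Ideal.mul_mem_left _ _ ?_
  exact Ideal.mem_map_of_mem _ (hx _)

end CyclicAlgebra

section Dedekind

variable {R : Type*} [CommRing R] [IsDedekindDomain R] {n : ℕ} {σ : R ≃+* R} {γ : R}

open scoped nonZeroDivisors in
lemma exists_smul_eq_smul_notMem {ι : Type*} [Finite ι] {x : ι → R} (hx : x ≠ 0)
    {J : Ideal R} (hJ : J ≠ ⊤) :
    ∃ c d : R, ∃ y : ι → R, c • x = d • y ∧ d ≠ 0 ∧ ∃ l, y l ∉ J := by
  have := Fintype.ofFinite ι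
  obtain ⟨j, hj⟩ := Function.ne_iff.1 hx
  let f (l : ι) : FractionRing R := algebraMap R (FractionRing R) (x l)
  have hf : f j ≠ 0 := by simpa [f] using hj
  obtain ⟨a, ha, l, -, hl⟩ :=
    Ideal.exist_integer_multiples_notMem hJ Finset.univ f (Finset.mem_univ j) hf
  choose y hy using fun l => ha l (Finset.mem_univ l)
  obtain ⟨c, d, hd, rfl⟩ := IsFractionRing.div_surjective (A := R) a
  have hd0 : d ≠ 0 := nonZeroDivisors.ne_zero hd
  refine ⟨c, d, y, funext fun l => ?_, hd0, l, fun hyl => hl ?_⟩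
  · have hdK : algebraMap R (FractionRing R) d ≠ 0 := by simpa using hd0
    apply IsFractionRing.injective R (FractionRing R)
    simp only [Pi.smul_apply, smul_eq_mul, map_mul, hy, f]
    field_simp
  · exact (FractionalIdeal.mem_coeIdeal _).2 ⟨y l, hyl, hy l⟩

theorem reducedNorm_ne_zero {S : Type*} [CommRing S] [Nontrivial S] {τ : S ≃+* S} (φ : R →+* S)
    (hφ : ∀ r, φ (σ r) = τ (φ r))
    (hanis : ∀ y : Fin n → S, reducedNorm τ (φ γ) y = 0 → y = 0) {x : Fin n → R} (hx : x ≠ 0) :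
    reducedNorm σ γ x ≠ 0 := by
  obtain ⟨c, d, y, hcd, hd, l, hl⟩ := exists_smul_eq_smul_notMem hx (RingHom.ker_ne_top φ)
  intro hx0
  have hy0 : reducedNorm σ γ y = 0 := by
    have h := reducedNorm_smul σ γ d y
    rw [← hcd, reducedNorm_smul, hx0, mul_zero, eq_comm, mul_eq_zero] at h
    exact h.resolve_left <| Finset.prod_ne_zero_iff.2 fun m _ =>
      (map_ne_zero_iff _ (σ ^ (m : ℕ)).injective).2 hd
  refine hl (congrFun (hanis (φ ∘ y) ?_) l)
  rw [← map_reducedNorm γ φ hφ, hy0, map_zero]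

variable [Module.Free ℤ R]

lemma absNorm_map_ringEquiv (σ : R ≃+* R) (a : Ideal R) :
    Ideal.absNorm (a.map σ) = Ideal.absNorm a := by
  rw [Ideal.absNorm_apply, Ideal.absNorm_apply]
  exact (Nat.card_congr (Ideal.quotientEquiv a (a.map σ) σ rfl).toEquiv).symm

lemma absNorm_span_reducedNorm_single_zero [NeZero n] (g : R) :
    Ideal.absNorm (Ideal.span {reducedNorm σ γ (Pi.single 0 g : Fin n → R)}) =
      Ideal.absNorm (Ideal.span {g}) ^ n := by
  rw [reducedNorm_single_zero, ← Ideal.prod_span_singleton, map_prod]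
  have h (m : Fin n) :
      Ideal.absNorm (Ideal.span {(σ ^ (m : ℕ)) g}) = Ideal.absNorm (Ideal.span {g}) := by
    rw [← absNorm_map_ringEquiv (σ ^ (m : ℕ)) (Ideal.span {g}), Ideal.map_span,
      Set.image_singleton]
  simp only [h, Finset.prod_const, Finset.card_univ, Fintype.card_fin]

lemma absNorm_pow_dvd_absNorm_span_reducedNorm {a : Ideal R} {x : Fin n → R} (hx : ∀ l, x l ∈ a) :
    Ideal.absNorm a ^ n ∣ Ideal.absNorm (Ideal.span {reducedNorm σ γ x}) := by
  have h := Ideal.absNorm_dvd_absNorm_of_le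
    ((Ideal.span_singleton_le_iff_mem _).2 (reducedNorm_mem_prod_map σ (γ := γ) hx))
  simpa only [map_prod, absNorm_map_ringEquiv, Finset.prod_const, Finset.card_univ,
    Fintype.card_fin] using h

end Dedekind

section ImaginaryQuadratic

lemma norm_eq_normSq {F : Type*} [Field F] [Algebra ℚ F] (h2 : Module.finrank ℚ F = 2)
    {ι : F →+* ℂ} (hι : ¬ NumberField.ComplexEmbedding.IsReal ι) (x : F) :
    (Algebra.norm ℚ x : ℝ) = Complex.normSq (ι x) := by
  classical
  have : FiniteDimensional ℚ F := .of_finrank_pos (by omega)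
  let f : F →ₐ[ℚ] ℂ := ι.toRatAlgHom
  let g : F →ₐ[ℚ] ℂ := (NumberField.ComplexEmbedding.conjugate ι).toRatAlgHom
  have hfg : f ≠ g := fun h => hι (congrArg AlgHom.toRingHom h).symm
  have huniv : Finset.univ = {f, g} := by
    refine (Finset.eq_of_subset_of_card_le (Finset.subset_univ _) ?_).symm
    rw [Finset.card_pair hfg, Finset.card_univ, AlgHom.card, h2]
  have h : ((Algebra.norm ℚ x : ℚ) : ℂ) = ι x * starRingEnd ℂ (ι x) := by
    rw [← eq_ratCast (algebraMap ℚ ℂ), Algebra.norm_eq_prod_embeddings, huniv, Finset.prod_pair hfg]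
    rfl
  rw [Complex.mul_conj] at h
  exact_mod_cast h

open NumberField in
lemma absNorm_span_eq_normSq_pow {F E : Type*} [Field F] [NumberField F] [Field E]
    [NumberField E] [Algebra F E] (h2 : Module.finrank ℚ F = 2) {ι : E →+* ℂ}
    (hι : ¬ NumberField.ComplexEmbedding.IsReal (ι.comp (algebraMap F E))) {d : 𝓞 E} {k : F}
    (hk : algebraMap F E k = d) :
    (Ideal.absNorm (Ideal.span {d}) : ℝ) = Complex.normSq (ι d) ^ Module.finrank F E := by
  have hnorm : Algebra.norm ℚ (d : E) = Algebra.norm ℚ k ^ Module.finrank F E := by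
    rw [← hk, ← Algebra.norm_norm (S := F), Algebra.norm_algebraMap, map_pow]
  have hι : ((Algebra.norm ℚ k : ℚ) : ℝ) = Complex.normSq (ι d) := by
    rw [norm_eq_normSq h2 hι, RingHom.comp_apply, hk]
  rw [Ideal.absNorm_span_singleton, Nat.cast_natAbs, Int.cast_abs, ← Rat.cast_intCast,
    Algebra.coe_norm_int, hnorm, Rat.cast_pow, hι,
    abs_of_nonneg (pow_nonneg (Complex.normSq_nonneg _) _)]

end ImaginaryQuadratic

section CyclicExtension

variable {F E : Type*} [Field F] [Field E] [Algebra F E] [FiniteDimensional F E] {σ : Gal(E/F)}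

lemma fixedField_zpowers_eq_bot (h : Module.finrank F E ≤ orderOf σ) :
    IntermediateField.fixedField (Subgroup.zpowers σ) = ⊥ := by
  have hcard := IntermediateField.finrank_fixedField_eq_card (Subgroup.zpowers σ)
  rw [Nat.card_zpowers] at hcard
  rw [← IntermediateField.finrank_eq_one_iff]
  have hmul := Module.finrank_mul_finrank F (IntermediateField.fixedField (Subgroup.zpowers σ)) E
  rw [hcard] at hmul
  have := orderOf_pos σ
  have := Module.finrank_pos (R := F) (M := IntermediateField.fixedField (Subgroup.zpowers σ))
  nlinarith

lemma finrank_eq_orderOf (h : Module.finrank F E ≤ orderOf σ) :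
    Module.finrank F E = orderOf σ := by
  rw [← Nat.card_zpowers, ← IntermediateField.finrank_fixedField_eq_card,
    fixedField_zpowers_eq_bot h, IntermediateField.finrank_bot']

lemma mem_range_algebraMap_of_apply_eq (h : Module.finrank F E ≤ orderOf σ) {x : E}
    (hx : σ x = x) : ∃ k, algebraMap F E k = x := by
  rw [← Set.mem_range, ← IntermediateField.mem_bot, ← fixedField_zpowers_eq_bot h,
    IntermediateField.mem_fixedField_iff]
  have hstab : Subgroup.zpowers σ ≤ MulAction.stabilizer Gal(E/F) x := by
    rwa [Subgroup.zpowers_le]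
  exact fun f hf => hstab hf

end CyclicExtension

section Extension

instance : FiniteDimensional ℚ K :=
  IntermediateField.adjoin.finiteDimensional Complex.isIntegral_rat_I

instance : FiniteDimensional K L :=
  IntermediateField.adjoin.finiteDimensional isIntegral_theta

instance : FiniteDimensional ℚ L := Module.Finite.trans K L

instance : NumberField K := ⟨⟩

instance : NumberField L := ⟨⟩

lemma finrank_K : Module.finrank ℚ K = 2 := by
  have hI : IsPrimitiveRoot Complex.I 4 := Complex.isPrimitiveRoot_I
  rw [IntermediateField.adjoin.finrank Complex.isIntegral_rat_I,
    ← Polynomial.cyclotomic_eq_minpoly_rat hI (by norm_num), Polynomial.natDegree_cyclotomic]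
  decide

lemma theta_quartic : theta ^ 4 - theta ^ 3 - 4 * theta ^ 2 + 4 * theta + 1 = 0 := by
  set w : ℂ := Complex.exp (2 * Real.pi * Complex.I / 15) with hw
  have hprim : IsPrimitiveRoot w 15 := by
    simpa using Complex.isPrimitiveRoot_exp 15 (by norm_num)
  have hw0 : w ≠ 0 := Complex.exp_ne_zero _
  have hth : theta = w + w⁻¹ := by
    rw [theta, Complex.two_cos, hw, ← Complex.exp_neg]
    congr 2 <;> ring
  have h15 : w ^ 15 = 1 := hprim.pow_eq_one
  have h5 : w ^ 5 - 1 ≠ 0 :=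
    sub_ne_zero.2 (hprim.pow_ne_one_of_pos_of_lt (by norm_num) (by norm_num))
  have h3 : w ^ 3 - 1 ≠ 0 :=
    sub_ne_zero.2 (hprim.pow_ne_one_of_pos_of_lt (by norm_num) (by norm_num))
  have hq : w ^ 2 + w + 1 ≠ 0 := fun h => h3 (by linear_combination (w - 1) * h)
  have hphi : w ^ 8 - w ^ 7 + w ^ 5 - w ^ 4 + w ^ 3 - w + 1 = 0 := by
    have : (w ^ 5 - 1) * ((w ^ 2 + w + 1) *
        (w ^ 8 - w ^ 7 + w ^ 5 - w ^ 4 + w ^ 3 - w + 1)) = 0 := by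
      linear_combination h15
    simpa [h5, hq] using this
  rw [hth]
  field_simp
  linear_combination hphi

lemma finrank_L_le : Module.finrank K L ≤ 4 := by
  have hpoly : (Polynomial.X ^ 4 - Polynomial.X ^ 3 - 4 * Polynomial.X ^ 2 + 4 * Polynomial.X + 1 :
      Polynomial K).natDegree = 4 := by
    compute_degree!
  rw [IntermediateField.adjoin.finrank isIntegral_theta, ← hpoly]
  refine Polynomial.natDegree_le_of_dvd (minpoly.dvd _ _ ?_)
    (Polynomial.ne_zero_of_natDegree_gt (n := 0) (by omega))
  simpa only [map_add, map_sub, map_mul, map_pow, Polynomial.aeval_X, map_ofNat, map_one]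
    using theta_quartic

/-- `θ` as an element of `L`. -/
abbrev thetaL : L := IntermediateField.AdjoinSimple.gen K theta

lemma algEquiv_ext {f g : Gal(L/K)} (h : f thetaL = g thetaL) : f = g :=
  AlgEquiv.coe_toAlgHom_injective <|
    IntermediateField.algHom_ext_of_eq_adjoin (S := L) (s := {theta}) _ rfl <| by
      rintro _ rfl
      exact h

lemma sigma_thetaL : sigma thetaL = thetaL ^ 2 - 2 :=
  Subtype.ext (sigma_theta.trans theta'_eq)

lemma coe_sigma_pow_thetaL (m : ℕ) :
    ((sigma ^ m) thetaL : ℂ) = (2 * Real.cos (2 ^ m * (2 * Real.pi / 15)) : ℝ) := by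
  induction m with
  | zero => simp [theta]
  | succ m ih =>
    have h : ((sigma ^ (m + 1)) thetaL : ℂ) = ((sigma ^ m) thetaL : ℂ) ^ 2 - 2 := by
      rw [pow_succ, AlgEquiv.mul_apply, sigma_thetaL, map_sub, map_pow, map_ofNat]
      rfl
    rw [h, ih, pow_succ' (2 : ℝ), mul_assoc, Real.cos_two_mul]
    push_cast
    ring

lemma sigma_pow_four : sigma ^ 4 = 1 := by
  refine algEquiv_ext (Subtype.ext ?_)
  have h : (2 ^ 4 * (2 * Real.pi / 15) : ℝ) = 2 ^ 0 * (2 * Real.pi / 15) + 2 * Real.pi := by ring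
  rw [coe_sigma_pow_thetaL, h, Real.cos_add_two_pi, ← coe_sigma_pow_thetaL, pow_zero]

lemma orderOf_sigma : orderOf sigma = 4 := by
  refine orderOf_eq_prime_pow (p := 2) (n := 1) (fun h => ?_) sigma_pow_four
  have hcos : Real.cos (2 ^ 2 * (2 * Real.pi / 15)) = Real.cos (2 ^ 0 * (2 * Real.pi / 15)) := by
    have := (coe_sigma_pow_thetaL 2).symm.trans ((congrArg (fun τ : Gal(L/K) => (τ thetaL : ℂ))
      (h : sigma ^ 2 = sigma ^ 0)).trans (coe_sigma_pow_thetaL 0))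
    exact mul_left_cancel₀ two_ne_zero (Complex.ofReal_injective this)
  have hπ := Real.pi_pos
  have := Real.injOn_cos ⟨by positivity, by linarith⟩ ⟨by positivity, by linarith⟩ hcos
  linarith

lemma finrank_L_le_orderOf_sigma : Module.finrank K L ≤ orderOf sigma :=
  finrank_L_le.trans_eq orderOf_sigma.symm

lemma finrank_L : Module.finrank K L = 4 :=
  (finrank_eq_orderOf finrank_L_le_orderOf_sigma).trans orderOf_sigma

lemma finrank_rat_L : Module.finrank ℚ L = 8 := by
  rw [← Module.finrank_mul_finrank ℚ K L, finrank_K, finrank_L]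

end Extension

section Integers

/-- The automorphism of `𝓞_L` induced by `σ`. -/
def sigmaInt : 𝓞 L ≃+* 𝓞 L := NumberField.RingOfIntegers.mapRingEquiv sigma.toRingEquiv

lemma coe_sigmaInt_pow (m : ℕ) (x : 𝓞 L) : ((sigmaInt ^ m) x : L) = (sigma ^ m) (x : L) := by
  induction m generalizing x with
  | zero => rfl
  | succ m ih =>
    rw [pow_succ, pow_succ, RingAut.mul_apply, AlgEquiv.mul_apply, ih]
    rfl

lemma sigmaInt_pow_four : sigmaInt ^ 4 = 1 :=
  RingEquiv.ext fun x => NumberField.RingOfIntegers.ext <| by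
    rw [coe_sigmaInt_pow, sigma_pow_four]
    rfl

/-- `i` as an element of `𝓞_L`. -/
def iInt : 𝓞 L :=
  ⟨algebraMap K L ⟨Complex.I, IntermediateField.mem_adjoin_simple_self ℚ Complex.I⟩,
    (isIntegral_algebraMap_iff (algebraMap L ℂ).injective).1 Complex.isIntegral_int_I⟩

lemma algebraMap_iInt : algebraMap (𝓞 L) ℂ iInt = Complex.I := rfl

lemma algebraMap_injective : Function.Injective (algebraMap (𝓞 L) ℂ) :=
  FaithfulSMul.algebraMap_injective _ _

lemma iInt_sq : iInt ^ 2 = -1 :=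
  algebraMap_injective <| by rw [map_pow, algebraMap_iInt, Complex.I_sq, map_neg, map_one]

lemma iInt_ne_zero : iInt ≠ 0 := fun h => by
  simpa [h] using iInt_sq

lemma sigmaInt_iInt : sigmaInt iInt = iInt :=
  NumberField.RingOfIntegers.ext (sigma.commutes _)

lemma isIntegral_int_theta : IsIntegral ℤ theta :=
  ⟨Polynomial.X ^ 4 - Polynomial.X ^ 3 - 4 * Polynomial.X ^ 2 + 4 * Polynomial.X + 1,
    by monicity!, by simpa using theta_quartic⟩

/-- `θ` as an element of `𝓞_L`. -/
def thetaInt : 𝓞 L :=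
  ⟨thetaL, (isIntegral_algebraMap_iff (algebraMap L ℂ).injective).1 isIntegral_int_theta⟩

lemma algebraMap_thetaInt : algebraMap (𝓞 L) ℂ thetaInt = theta := rfl

lemma thetaInt_quartic :
    thetaInt ^ 4 - thetaInt ^ 3 - 4 * thetaInt ^ 2 + 4 * thetaInt + 1 = 0 :=
  algebraMap_injective <| by
    simpa only [map_add, map_sub, map_mul, map_pow, map_ofNat, map_one, map_zero,
      algebraMap_thetaInt] using theta_quartic

lemma absNorm_span_of_sigmaInt_eq {d : 𝓞 L} (hd : sigmaInt d = d) :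
    (Ideal.absNorm (Ideal.span {d}) : ℝ) = Complex.normSq (algebraMap (𝓞 L) ℂ d) ^ 4 := by
  obtain ⟨k, hk⟩ := mem_range_algebraMap_of_apply_eq finrank_L_le_orderOf_sigma
    (congrArg (algebraMap (𝓞 L) L) hd)
  have hI : ¬ NumberField.ComplexEmbedding.IsReal
      ((algebraMap L ℂ).comp (algebraMap K L)) := fun h => by
    have hconj : starRingEnd ℂ Complex.I = Complex.I :=
      RingHom.congr_fun h ⟨Complex.I, IntermediateField.mem_adjoin_simple_self ℚ Complex.I⟩
    norm_num [Complex.ext_iff] at hconj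
  rw [absNorm_span_eq_normSq_pow finrank_K hI hk, finrank_L]
  rfl

end Integers

section ResidueMap

lemma two_add_iInt_mul_two_sub_iInt : (2 + iInt) * (2 - iInt) = 5 := by
  linear_combination -iInt_sq

lemma span_two_add_iInt_ne_top : Ideal.span {2 + iInt} ≠ ⊤ := fun h => by
  have hnorm := absNorm_span_of_sigmaInt_eq (d := 2 + iInt)
    (by rw [map_add, map_ofNat, sigmaInt_iInt])
  rw [h, Ideal.absNorm_top, map_add, map_ofNat, algebraMap_iInt] at hnorm
  norm_num [Complex.normSq_apply] at hnorm

lemma span_two_sub_iInt_ne_top : Ideal.span {2 - iInt} ≠ ⊤ := fun h => by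
  have hnorm := absNorm_span_of_sigmaInt_eq (d := 2 - iInt)
    (by rw [map_sub, map_ofNat, sigmaInt_iInt])
  rw [h, Ideal.absNorm_top, map_sub, map_ofNat, algebraMap_iInt] at hnorm
  norm_num [Complex.normSq_apply] at hnorm

lemma associated_thetaInt_add_one_pow_four : Associated ((thetaInt + 1) ^ 4) 5 := by
  have htheta : IsUnit thetaInt :=
    .of_mul_eq_one (-(thetaInt - 1) * (thetaInt ^ 2 - 4)) (by linear_combination -thetaInt_quartic)
  have htheta_add_two : IsUnit (thetaInt + 2) :=
    .of_mul_eq_one (-thetaInt * (thetaInt - 1) * (thetaInt - 2))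
      (by linear_combination -thetaInt_quartic)
  refine Associated.symm ⟨((htheta.pow 2).mul htheta_add_two).unit, ?_⟩
  rw [IsUnit.unit_spec]
  linear_combination -thetaInt_quartic

lemma absNorm_span_thetaInt_add_one : Ideal.absNorm (Ideal.span {thetaInt + 1}) = 25 := by
  have h5 : Ideal.absNorm (Ideal.span {(5 : 𝓞 L)}) = 25 ^ 4 := by
    have := Ideal.absNorm_span_natCast (S := 𝓞 L) 5
    rw [NumberField.RingOfIntegers.rank, finrank_rat_L] at this
    exact this
  rw [← Ideal.span_singleton_eq_span_singleton.2 associated_thetaInt_add_one_pow_four,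
    ← Ideal.span_singleton_pow, map_pow] at h5
  exact Nat.pow_left_injective four_ne_zero h5

variable {P Q : Ideal (𝓞 L)}

lemma isCoprime_of_two_add_iInt_mem (hP : 2 + iInt ∈ P) (hQ : 2 - iInt ∈ Q) : IsCoprime P Q :=
  Ideal.isCoprime_iff_exists.2 ⟨(2 + iInt) * (1 - iInt), P.mul_mem_right _ hP, -(2 - iInt),
    Q.neg_mem hQ, by linear_combination -iInt_sq⟩

lemma thetaInt_add_one_mem [P.IsPrime] (hP : 5 ∈ P) : thetaInt + 1 ∈ P :=
  ‹P.IsPrime›.mem_of_pow_mem 4 <|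
    P.mem_of_dvd associated_thetaInt_add_one_pow_four.symm.dvd hP

lemma absNorm_eq_five_and_mul_eq [P.IsPrime] [Q.IsPrime] (hP : 2 + iInt ∈ P)
    (hQ : 2 - iInt ∈ Q) : Ideal.absNorm P = 5 ∧ P * Q = Ideal.span {thetaInt + 1} := by
  have h5P : 5 ∈ P := two_add_iInt_mul_two_sub_iInt ▸ P.mul_mem_right _ hP
  have h5Q : 5 ∈ Q := two_add_iInt_mul_two_sub_iInt ▸ Q.mul_mem_left _ hQ
  have hle : Ideal.span {thetaInt + 1} ≤ P * Q := by
    rw [Ideal.mul_eq_inf_of_isCoprime (isCoprime_of_two_add_iInt_mem hP hQ),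
      Ideal.span_singleton_le_iff_mem]
    exact ⟨thetaInt_add_one_mem h5P, thetaInt_add_one_mem h5Q⟩
  obtain ⟨c, hc⟩ := Ideal.dvd_iff_le.2 hle
  have hnorm : Ideal.absNorm P * (Ideal.absNorm Q * Ideal.absNorm c) = 5 ^ 2 := by
    rw [← mul_assoc, ← map_mul, ← map_mul, ← hc, absNorm_span_thetaInt_add_one]
    norm_num
  have hP1 : Ideal.absNorm P ≠ 1 := Ideal.absNorm_eq_one_iff.not.2 Ideal.IsPrime.ne_top'
  have hQ1 : Ideal.absNorm Q ≠ 1 := Ideal.absNorm_eq_one_iff.not.2 Ideal.IsPrime.ne_top'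
  obtain ⟨hP5, hQc⟩ := (Nat.prime_five.mul_eq_prime_sq_iff hP1
    fun h => hQ1 (Nat.eq_one_of_mul_eq_one_right h)).1 hnorm
  have hQ5 : Ideal.absNorm Q = 5 :=
    (Nat.prime_five.eq_one_or_self_of_dvd _ (Dvd.intro _ hQc)).resolve_left hQ1
  have hc1 : Ideal.absNorm c = 1 := by
    rwa [hQ5, Nat.mul_eq_left (by norm_num)] at hQc
  rw [Ideal.absNorm_eq_one_iff.1 hc1, Ideal.mul_top] at hc
  exact ⟨hP5, hc.symm⟩

lemma eq_of_two_add_iInt_mem {P' : Ideal (𝓞 L)} [P.IsMaximal] [P'.IsMaximal]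
    (hP : 2 + iInt ∈ P) (hP' : 2 + iInt ∈ P') : P = P' := by
  obtain ⟨Q, hQ, hQle⟩ := Ideal.exists_le_maximal _ span_two_sub_iInt_ne_top
  rw [Ideal.span_singleton_le_iff_mem] at hQle
  have hmul : P * Q = P' * Q :=
    (absNorm_eq_five_and_mul_eq hP hQle).2.trans (absNorm_eq_five_and_mul_eq hP' hQle).2.symm
  have hQ0 : Q ≠ 0 := fun h => by
    have hnorm := absNorm_span_thetaInt_add_one
    rw [← (absNorm_eq_five_and_mul_eq hP hQle).2, h, mul_zero, map_zero] at hnorm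
    norm_num at hnorm
  exact mul_right_cancel₀ hQ0 hmul

lemma exists_ringHom_zmod_ker_eq {R : Type*} [CommRing R] [IsDedekindDomain R] [Module.Free ℤ R]
    {P : Ideal R} {p : ℕ} (hp : p.Prime) (hP : Ideal.absNorm P = p) :
    ∃ φ : R →+* ZMod p, RingHom.ker φ = P := by
  have hcard : Nat.card (R ⧸ P) = p := hP
  have : Finite (R ⧸ P) := Nat.finite_of_card_ne_zero (hcard ▸ hp.ne_zero)
  have := Fintype.ofFinite (R ⧸ P)
  let e := (ZMod.ringEquivOfPrime (R ⧸ P) hp (Nat.card_eq_fintype_card.symm.trans hcard)).symm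
  refine ⟨e.toRingHom.comp (Ideal.Quotient.mk P), ?_⟩
  rw [RingHom.ker_equiv_comp, Ideal.mk_ker]

theorem exists_residueMap :
    ∃ φ : 𝓞 L →+* ZMod 5, φ iInt = 3 ∧ ∀ x, φ (sigmaInt x) = φ x := by
  have : Fact (Nat.Prime 5) := ⟨Nat.prime_five⟩
  obtain ⟨P, hPmax, hP⟩ := Ideal.exists_le_maximal _ span_two_add_iInt_ne_top
  obtain ⟨Q, hQmax, hQ⟩ := Ideal.exists_le_maximal _ span_two_sub_iInt_ne_top
  rw [Ideal.span_singleton_le_iff_mem] at hP hQ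
  obtain ⟨φ, rfl⟩ := exists_ringHom_zmod_ker_eq Nat.prime_five (absNorm_eq_five_and_mul_eq hP hQ).1
  have hφi : φ iInt = 3 := by
    rw [RingHom.mem_ker, map_add, map_ofNat] at hP
    exact eq_neg_of_add_eq_zero_right hP
  let ψ : 𝓞 L →+* ZMod 5 := φ.comp (sigmaInt : 𝓞 L →+* 𝓞 L)
  have := RingHom.ker_isMaximal_of_surjective ψ (ZMod.ringHom_surjective ψ)
  refine ⟨φ, hφi, RingHom.congr_fun (f := ψ) ?_⟩
  refine ZMod.ringHom_eq_of_ker_eq _ _ (eq_of_two_add_iInt_mem ?_ hP)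
  rwa [RingHom.mem_ker, RingHom.comp_apply, RingHom.coe_coe, map_add, map_ofNat, sigmaInt_iInt]

end ResidueMap

section Anisotropy

lemma eq_zero_of_sq_sub_three_mul_sq :
    ∀ p r : ZMod 5, p ^ 2 - 3 * r ^ 2 = 0 → p = 0 ∧ r = 0 := by
  decide

lemma eq_zero_of_norm_coeffs : ∀ a b c d : ZMod 5,
    a ^ 2 + 3 * c ^ 2 - 6 * (b * d) = 0 → 2 * (a * c) - b ^ 2 - 3 * d ^ 2 = 0 →
      a = 0 ∧ b = 0 ∧ c = 0 ∧ d = 0 := by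
  decide

/-- With `f = e²`, the norm of `y` from `R[e]` to `R[f]` is
`(y₀ + y₂ f)² - f (y₁ + y₃ f)² = p + r f`, and that of `p + r f` to `R` is `p² - γ r²`. -/
lemma reducedNorm_one_fin_four {R : Type*} [CommRing R] (γ : R) (y : Fin 4 → R) :
    reducedNorm 1 γ y = (y 0 ^ 2 + γ * y 2 ^ 2 - 2 * γ * (y 1 * y 3)) ^ 2 -
      γ * (2 * (y 0 * y 2) - y 1 ^ 2 - γ * y 3 ^ 2) ^ 2 := by
  have hmat : cyclicMatrix 1 γ y = !![y 0, y 1, y 2, y 3; γ * y 3, y 0, y 1, y 2;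
      γ * y 2, γ * y 3, y 0, y 1; γ * y 1, γ * y 2, γ * y 3, y 0] := by
    ext m j
    rw [cyclicMatrix_apply, one_pow, RingAut.one_apply]
    fin_cases m <;> fin_cases j <;> simp <;> rfl
  rw [reducedNorm, hmat, Matrix.det_succ_row_zero]
  simp only [Matrix.of_apply, Matrix.submatrix_apply, Matrix.cons_val, Matrix.det_fin_three,
    Fin.sum_univ_four, Fin.succAbove, Fin.reduceSucc, Fin.reduceCastSucc, Fin.coe_ofNat_eq_mod,
    Fin.reduceLT, ↓reduceIte]
  ring

lemma eq_zero_of_reducedNorm_zmod_five (y : Fin 4 → ZMod 5) (hy : reducedNorm 1 3 y = 0) :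
    y = 0 := by
  rw [reducedNorm_one_fin_four] at hy
  obtain ⟨hp, hr⟩ := eq_zero_of_sq_sub_three_mul_sq _ _ hy
  obtain ⟨h0, h1, h2, h3⟩ := eq_zero_of_norm_coeffs _ _ _ _ hp hr
  ext l
  fin_cases l
  exacts [h0, h1, h2, h3]

end Anisotropy

section Determinants

/-- The reduced norm of `x₀ + x₁ e + x₂ e² + x₃ e³` in the cyclic algebra `(L/K, σ, i)`. -/
def nrd (x : Fin 4 → 𝓞 L) : 𝓞 L := reducedNorm sigmaInt iInt x

lemma nrd_ne_zero {x : Fin 4 → 𝓞 L} (hx : x ≠ 0) : nrd x ≠ 0 := by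
  have : Fact (Nat.Prime 5) := ⟨Nat.prime_five⟩
  obtain ⟨φ, hφi, hφσ⟩ := exists_residueMap
  refine reducedNorm_ne_zero (τ := 1) φ hφσ (fun y hy => ?_) hx
  rw [hφi] at hy
  exact eq_zero_of_reducedNorm_zmod_five y hy

lemma absNorm_span_nrd (x : Fin 4 → 𝓞 L) :
    (Ideal.absNorm (Ideal.span {nrd x}) : ℝ) =
      Complex.normSq (algebraMap (𝓞 L) ℂ (nrd x)) ^ 4 :=
  absNorm_span_of_sigmaInt_eq (apply_reducedNorm sigmaInt_pow_four sigmaInt_iInt iInt_ne_zero x)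

lemma absNorm_le_normSq_nrd {a : Ideal (𝓞 L)} {x : Fin 4 → 𝓞 L} (hx : x ≠ 0)
    (hxa : ∀ l, x l ∈ a) :
    (Ideal.absNorm a : ℝ) ≤ Complex.normSq (algebraMap (𝓞 L) ℂ (nrd x)) := by
  have hnorm : Ideal.absNorm (Ideal.span {nrd x}) ≠ 0 := by
    simpa [Ideal.absNorm_eq_zero_iff] using nrd_ne_zero hx
  rw [← pow_le_pow_iff_left₀ (Nat.cast_nonneg _) (Complex.normSq_nonneg _) four_ne_zero,
    ← absNorm_span_nrd]
  exact_mod_cast Nat.le_of_dvd (Nat.pos_of_ne_zero hnorm)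
    (absNorm_pow_dvd_absNorm_span_reducedNorm hxa)

lemma normSq_nrd_single_zero (g : 𝓞 L) :
    Complex.normSq (algebraMap (𝓞 L) ℂ (nrd (Pi.single 0 g))) =
      Ideal.absNorm (Ideal.span {g}) := by
  rw [← pow_left_inj₀ (Complex.normSq_nonneg _) (Nat.cast_nonneg _) four_ne_zero,
    ← absNorm_span_nrd, nrd, absNorm_span_reducedNorm_single_zero, Nat.cast_pow]

lemma alpha_ne_zero : alpha ≠ 0 := by
  intro h
  have h' : (1 - 3 * Complex.I) + Complex.I * theta ^ 2 = 0 := congrArg Subtype.val h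
  obtain ⟨r, hr⟩ : ∃ r : ℝ, theta ^ 2 = r := ⟨(2 * Real.cos (2 * Real.pi / 15)) ^ 2, by
    rw [theta]
    push_cast
    rfl⟩
  rw [hr] at h'
  simpa using congrArg Complex.re h'

lemma det_diagMatrix_ne_zero {a : L} (ha : a ≠ 0) : (diagMatrix a).det ≠ 0 := by
  rw [diagMatrix, Matrix.det_diagonal, Finset.prod_ne_zero_iff]
  exact fun m _ => Subtype.coe_ne_coe.2 ((map_ne_zero_iff _ (sigma ^ (m : ℕ)).injective).2 ha)

/-- `|N_{L/K}(α)|²`, by which the shaping matrix `diag(α, σ(α), σ²(α), σ³(α))` scales every pair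
determinant. -/
def detScale : ℝ := Complex.normSq (diagMatrix alpha).det

lemma detScale_pos : 0 < detScale :=
  Complex.normSq_pos.2 (det_diagMatrix_ne_zero alpha_ne_zero)

lemma algMatrix_eq_map_cyclicMatrix (x : Fin 4 → 𝓞 L) :
    algMatrix (fun l => (x l : L)) =
      (cyclicMatrix sigmaInt iInt x).map (algebraMap (𝓞 L) ℂ) := by
  ext m j
  have hcoe : algebraMap (𝓞 L) ℂ ((sigmaInt ^ (m : ℕ)) (x (j - m))) =
      ((sigma ^ (m : ℕ)) (x (j - m) : L) : ℂ) :=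
    congrArg (algebraMap L ℂ) (coe_sigmaInt_pow _ _)
  rw [Matrix.map_apply, cyclicMatrix_apply, map_mul, apply_ite (algebraMap (𝓞 L) ℂ), map_one,
    algebraMap_iInt, hcoe]
  rfl

lemma codeword_add (x y : Fin 4 → 𝓞 L) : codeword (x + y) = codeword x + codeword y := by
  simp only [codeword, algMatrix_eq_map_cyclicMatrix, cyclicMatrix_add, ← mul_add,
    Matrix.map_add _ (map_add (algebraMap (𝓞 L) ℂ))]

lemma codeword_sub (x y : Fin 4 → 𝓞 L) : codeword (x - y) = codeword x - codeword y := by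
  rw [eq_sub_iff_add_eq, ← codeword_add, sub_add_cancel]

lemma det_codeword (x : Fin 4 → 𝓞 L) :
    (codeword x).det = (diagMatrix alpha).det * algebraMap (𝓞 L) ℂ (nrd x) := by
  rw [codeword, Matrix.det_mul, algMatrix_eq_map_cyclicMatrix, nrd, reducedNorm, RingHom.map_det,
    RingHom.mapMatrix_apply]

lemma re_det_codeword_mul_conjTranspose (x : Fin 4 → 𝓞 L) :
    (codeword x * (codeword x).conjTranspose).det.re =
      detScale * Complex.normSq (algebraMap (𝓞 L) ℂ (nrd x)) := by
  rw [Matrix.det_mul, Matrix.det_conjTranspose, ← starRingEnd_apply, Complex.mul_conj,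
    Complex.ofReal_re, det_codeword, map_mul, detScale]

lemma codeword_injective : Function.Injective codeword := by
  intro x y hxy
  by_contra hne
  have hdet := det_codeword (x - y)
  rw [codeword_sub, hxy, sub_self, Matrix.det_zero, eq_comm] at hdet
  refine mul_ne_zero (det_diagMatrix_ne_zero alpha_ne_zero) ?_ hdet
  exact (map_ne_zero_iff _ algebraMap_injective).2 (nrd_ne_zero (sub_ne_zero.2 hne))

/-- The values of `det (X X†)` at the nonzero codewords `X` whose layers lie in `a`; by translation
they are the pair determinants of the lattice code in which the layers are known modulo `a`. -/
def idealDets (a : Ideal (𝓞 L)) : Set ℝ :=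
  (fun x => detScale * Complex.normSq (algebraMap (𝓞 L) ℂ (nrd x))) ''
    {x : Fin 4 → 𝓞 L | x ≠ 0 ∧ ∀ l, x l ∈ a}

variable {a : Ideal (𝓞 L)}

lemma single_zero_mem {g : 𝓞 L} (hga : g ∈ a) (l : Fin 4) :
    (Pi.single 0 g : Fin 4 → 𝓞 L) l ∈ a := by
  obtain rfl | hl := eq_or_ne l 0
  · rwa [Pi.single_eq_same]
  · rw [Pi.single_eq_of_ne hl]
    exact a.zero_mem

lemma isLeast_sInf_idealDets (ha : a ≠ ⊥) : IsLeast (idealDets a) (sInf (idealDets a)) := by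
  suffices ∃ d, IsLeast (idealDets a) d by
    obtain ⟨d, hd⟩ := this
    rwa [hd.csInf_eq]
  obtain ⟨g, hga, hg⟩ := Submodule.exists_mem_ne_zero_of_ne_bot ha
  obtain ⟨x, hx, hmin⟩ := WellFounded.has_min
    (measure fun x : Fin 4 → 𝓞 L => Ideal.absNorm (Ideal.span {nrd x})).wf
    {x | x ≠ 0 ∧ ∀ l, x l ∈ a}
    ⟨Pi.single 0 g, Pi.single_ne_zero_iff.2 hg, single_zero_mem hga⟩
  refine ⟨_, Set.mem_image_of_mem _ hx, Set.forall_mem_image.2 fun y hy => ?_⟩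
  refine mul_le_mul_of_nonneg_left ?_ detScale_pos.le
  rw [← pow_le_pow_iff_left₀ (Complex.normSq_nonneg _) (Complex.normSq_nonneg _) four_ne_zero,
    ← absNorm_span_nrd, ← absNorm_span_nrd]
  exact_mod_cast not_lt.1 (hmin y hy)

lemma detScale_mul_absNorm_le {d : ℝ} (hd : d ∈ idealDets a) :
    detScale * Ideal.absNorm a ≤ d := by
  obtain ⟨x, ⟨hx, hxa⟩, rfl⟩ := hd
  exact mul_le_mul_of_nonneg_left (absNorm_le_normSq_nrd hx hxa) detScale_pos.le

lemma isLeast_idealDets_span {g : 𝓞 L} (hg : g ≠ 0) :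
    IsLeast (idealDets (Ideal.span {g})) (detScale * Ideal.absNorm (Ideal.span {g})) := by
  refine ⟨⟨Pi.single 0 g, ⟨Pi.single_ne_zero_iff.2 hg, ?_⟩, ?_⟩,
    fun d hd => detScale_mul_absNorm_le hd⟩
  · exact single_zero_mem (Ideal.mem_span_singleton_self g)
  · exact congrArg _ (normSq_nrd_single_zero g)

end Determinants

section IndexCode

variable {N : ℕ} {q : Fin N → Ideal (𝓞 L)} {M : (∀ k, 𝓞 L ⧸ q k) → 𝓞 L}

lemma mem_prod_iff (hq : Pairwise fun j k => IsCoprime (q j) (q k)) {S : Finset (Fin N)}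
    {x : 𝓞 L} : x ∈ ∏ s ∈ S, q s ↔ ∀ s ∈ S, Ideal.Quotient.mk (q s) x = 0 := by
  simp only [Ideal.prod_eq_iInf_of_pairwise_isCoprime fun _ _ _ _ h => hq h, Submodule.mem_iInf,
    Ideal.Quotient.eq_zero_iff_mem]

lemma mem_latticeCode_subcode_iff (hq : Pairwise fun j k => IsCoprime (q j) (q k))
    (hM : IsCosetLeaderMap q M) {S : Finset (Fin N)} {v : ∀ k, Message q k}
    {X : Matrix (Fin 4) (Fin 4) ℂ} :
    X ∈ latticeCode q (subcode M S v) ↔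
      ∃ x : Fin 4 → 𝓞 L, (∀ s ∈ S, ∀ l, Ideal.Quotient.mk (q s) (x l) = v s l) ∧
        X = codeword x := by
  constructor
  · rintro ⟨_, ⟨w, hw, rfl⟩, z, hz, rfl⟩
    refine ⟨(fun l => M fun k => w k l) + z, fun s hs l => ?_, (codeword_add _ _).symm⟩
    rw [Pi.add_apply, map_add, (mem_prod_iff hq).1 (hz l) s (Finset.mem_univ s), add_zero, hM,
      hw s hs]
  · rintro ⟨x, hx, rfl⟩
    let w (k : Fin N) : Message q k := fun l => Ideal.Quotient.mk (q k) (x l)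
    refine ⟨encode M w, ⟨w, fun s hs => funext (hx s hs), rfl⟩, x - fun l => M fun k => w k l,
      fun l => (mem_prod_iff hq).2 fun k _ => ?_, ?_⟩
    · rw [Pi.sub_apply, map_sub, hM, sub_self]
    · rw [encode, ← codeword_add, add_sub_cancel]

lemma pairDets_latticeCode_subcode (hq : Pairwise fun j k => IsCoprime (q j) (q k))
    (hM : IsCosetLeaderMap q M) (S : Finset (Fin N)) (v : ∀ k, Message q k) :
    pairDets (latticeCode q (subcode M S v)) = idealDets (∏ s ∈ S, q s) := by
  ext d
  constructor
  · rintro ⟨X, hX, X', hX', hne, rfl⟩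
    obtain ⟨x, hx, rfl⟩ := (mem_latticeCode_subcode_iff hq hM).1 hX
    obtain ⟨x', hx', rfl⟩ := (mem_latticeCode_subcode_iff hq hM).1 hX'
    refine ⟨x - x', ⟨fun h => hne (by rw [sub_eq_zero.1 h]), fun l => ?_⟩, ?_⟩
    · refine (mem_prod_iff hq).2 fun s hs => ?_
      rw [Pi.sub_apply, map_sub, hx s hs, hx' s hs, sub_self]
    · rw [← codeword_sub, re_det_codeword_mul_conjTranspose]
  · rintro ⟨z, ⟨hz, hza⟩, rfl⟩
    let x : Fin 4 → 𝓞 L := fun l => M fun k => v k l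
    have hx : ∀ s ∈ S, ∀ l, Ideal.Quotient.mk (q s) (x l) = v s l := fun s _ l => hM _ s
    have hxz : ∀ s ∈ S, ∀ l, Ideal.Quotient.mk (q s) ((x + z) l) = v s l := fun s hs l => by
      rw [Pi.add_apply, map_add, hx s hs, (mem_prod_iff hq).1 (hza l) s hs, add_zero]
    refine ⟨_, (mem_latticeCode_subcode_iff hq hM).2 ⟨x + z, hxz, rfl⟩,
      _, (mem_latticeCode_subcode_iff hq hM).2 ⟨x, hx, rfl⟩, ?_, ?_⟩
    · exact fun h => hz (add_eq_left.1 (codeword_injective h))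
    · rw [← codeword_sub, add_sub_cancel_left, re_det_codeword_mul_conjTranspose]

lemma codebook_eq_subcode_empty (v : ∀ k, Message q k) : codebook M = subcode M ∅ v := by
  ext X
  simp [codebook, subcode]

variable {S : Finset (Fin N)}

lemma sum_rate (hq0 : ∀ s ∈ S, q s ≠ ⊥) :
    ∑ s ∈ S, rate q s = Real.logb 2 (Ideal.absNorm (∏ s ∈ S, q s)) / 8 := by
  have hcard (k : Fin N) : (Nat.card (Message q k) : ℝ) = (Ideal.absNorm (q k) : ℝ) ^ 4 := by
    rw [Nat.card_fun, Nat.card_fin, Nat.cast_pow]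
    rfl
  rw [map_prod, Nat.cast_prod, Real.logb_prod, Finset.sum_div]
  · refine Finset.sum_congr rfl fun s _ => ?_
    rw [rate, hcard, Real.logb_pow]
    push_cast
    ring
  · intro s hs
    exact_mod_cast Ideal.absNorm_eq_zero_iff.not.2 (hq0 s hs)

lemma one_lt_absNorm_prod (hq0 : ∀ s ∈ S, q s ≠ ⊥) (hS : ∃ s ∈ S, q s ≠ ⊤) :
    1 < Ideal.absNorm (∏ s ∈ S, q s) := by
  obtain ⟨s, hs, htop⟩ := hS
  have h0 : Ideal.absNorm (∏ s ∈ S, q s) ≠ 0 :=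
    Ideal.absNorm_eq_zero_iff.not.2 (Finset.prod_ne_zero_iff.2 hq0)
  have h1 : Ideal.absNorm (∏ s ∈ S, q s) ≠ 1 := fun h => htop <| top_le_iff.1 <|
    (Ideal.absNorm_eq_one_iff.1 h).ge.trans (Ideal.dvd_iff_le.1 (Finset.dvd_prod_of_mem q hs))
  omega

lemma sideInfoGain_eq_mul_logb (hq0 : ∀ s ∈ S, q s ≠ ⊥) (v : ∀ k, Message q k) :
    sideInfoGain M S v = 20 * Real.logb 10 2 * Real.logb (Ideal.absNorm (∏ s ∈ S, q s))
      (minDet q (subcode M S v) / minDet q (codebook M)) := by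
  have hlog : Real.log 2 ≠ 0 := (Real.log_pos one_lt_two).ne'
  rw [sideInfoGain, sum_rate hq0]
  simp only [Real.logb]
  field_simp
  ring

variable (hq : Pairwise fun j k => IsCoprime (q j) (q k)) (hM : IsCosetLeaderMap q M)
include hq hM

lemma isLeast_minDet_subcode (hq0 : ∀ s ∈ S, q s ≠ ⊥) (v : ∀ k, Message q k) :
    IsLeast (pairDets (latticeCode q (subcode M S v))) (minDet q (subcode M S v)) := by
  rw [minDet, pairDets_latticeCode_subcode hq hM]
  exact isLeast_sInf_idealDets (Finset.prod_ne_zero_iff.2 hq0)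

lemma detScale_mul_absNorm_le_minDet_subcode (hq0 : ∀ s ∈ S, q s ≠ ⊥) (v : ∀ k, Message q k) :
    detScale * Ideal.absNorm (∏ s ∈ S, q s) ≤ minDet q (subcode M S v) := by
  have hmem := (isLeast_minDet_subcode hq hM hq0 v).1
  rw [pairDets_latticeCode_subcode hq hM] at hmem
  exact detScale_mul_absNorm_le hmem

lemma minDet_subcode_of_prod_eq_span {g : 𝓞 L} (hg : g ≠ 0)
    (hprod : ∏ s ∈ S, q s = Ideal.span {g}) (v : ∀ k, Message q k) :
    minDet q (subcode M S v) = detScale * Ideal.absNorm (∏ s ∈ S, q s) := by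
  rw [minDet, pairDets_latticeCode_subcode hq hM, hprod]
  exact (isLeast_idealDets_span hg).csInf_eq

lemma isLeast_minDet_codebook :
    IsLeast (pairDets (latticeCode q (codebook M))) (minDet q (codebook M)) := by
  rw [codebook_eq_subcode_empty 0]
  exact isLeast_minDet_subcode hq hM (by simp) 0

lemma minDet_codebook : minDet q (codebook M) = detScale := by
  rw [codebook_eq_subcode_empty 0,
    minDet_subcode_of_prod_eq_span hq hM one_ne_zero (by simp) 0]
  simp

theorem le_sideInfoGain (hq0 : ∀ s ∈ S, q s ≠ ⊥) (hS : ∃ s ∈ S, q s ≠ ⊤) (v : ∀ k, Message q k) :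
    20 * Real.logb 10 2 ≤ sideInfoGain M S v := by
  have hA : (1 : ℝ) < Ideal.absNorm (∏ s ∈ S, q s) := by
    exact_mod_cast one_lt_absNorm_prod hq0 hS
  have hratio : (Ideal.absNorm (∏ s ∈ S, q s) : ℝ) ≤ minDet q (subcode M S v) / detScale := by
    rw [le_div_iff₀' detScale_pos]
    exact detScale_mul_absNorm_le_minDet_subcode hq hM hq0 v
  rw [sideInfoGain_eq_mul_logb hq0, minDet_codebook hq hM]
  refine le_mul_of_one_le_right (mul_nonneg (by norm_num) (Real.logb_nonneg ?_ ?_)) ?_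
  · norm_num
  · norm_num
  · rw [Real.le_logb_iff_rpow_le hA (by linarith), Real.rpow_one]
    exact hratio

theorem sideInfoGain_eq_of_isPrincipal (hq0 : ∀ s ∈ S, q s ≠ ⊥) (hS : ∃ s ∈ S, q s ≠ ⊤)
    (hprin : (∏ s ∈ S, q s).IsPrincipal) (v : ∀ k, Message q k) :
    sideInfoGain M S v = 20 * Real.logb 10 2 := by
  have hA : (1 : ℝ) < Ideal.absNorm (∏ s ∈ S, q s) := by
    exact_mod_cast one_lt_absNorm_prod hq0 hS
  obtain ⟨g, hg⟩ := hprin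
  have hg0 : g ≠ 0 := by
    rintro rfl
    exact Finset.prod_ne_zero_iff.2 hq0 (hg.trans (Submodule.span_zero_singleton _))
  rw [sideInfoGain_eq_mul_logb hq0, minDet_codebook hq hM,
    minDet_subcode_of_prod_eq_span hq hM hg0 hg, mul_div_cancel_left₀ _ detScale_pos.ne',
    Real.logb_self_eq_one hA, mul_one]

end IndexCode

end

end LSTIC

/-- The constant "6 dB" is `20 log₁₀ 2 ≈ 6.02`. -/
theorem mainTheorem5 (N : ℕ) (q : Fin N → Ideal (NumberField.RingOfIntegers LSTIC.L))
    (hq_ne_bot : ∀ k, q k ≠ ⊥)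
    (hq_coprime : Pairwise fun j k => IsCoprime (q j) (q k))
    (M : (∀ k, NumberField.RingOfIntegers LSTIC.L ⧸ q k) →
      NumberField.RingOfIntegers LSTIC.L)
    (hM : LSTIC.IsCosetLeaderMap q M)
    (S : Finset (Fin N)) (hS : ∃ s ∈ S, q s ≠ ⊤)
    (v : ∀ k, LSTIC.Message q k) :
    IsLeast (LSTIC.pairDets (LSTIC.latticeCode q (LSTIC.codebook M)))
        (LSTIC.minDet q (LSTIC.codebook M)) ∧
      IsLeast (LSTIC.pairDets (LSTIC.latticeCode q (LSTIC.subcode M S v)))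
        (LSTIC.minDet q (LSTIC.subcode M S v)) ∧
      20 * Real.logb 10 2 ≤ LSTIC.sideInfoGain M S v ∧
      ((∀ k, Submodule.IsPrincipal (q k)) →
        LSTIC.sideInfoGain M S v = 20 * Real.logb 10 2) := by
  have hq0 : ∀ s ∈ S, q s ≠ ⊥ := fun s _ => hq_ne_bot s
  refine ⟨LSTIC.isLeast_minDet_codebook hq_coprime hM,
    LSTIC.isLeast_minDet_subcode hq_coprime hM hq0 v,
    LSTIC.le_sideInfoGain hq_coprime hM hq0 hS v, fun hprin => ?_⟩
  have hprod : (∏ s ∈ S, q s).IsPrincipal :=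
    Submonoid.prod_mem (Ideal.isPrincipalSubmonoid _) fun s _ => hprin s
  exact LSTIC.sideInfoGain_eq_of_isPrincipal hq_coprime hM hq0 hS hprod v
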